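/- Let $T\in(0,\infty)$, let $(\Omega,\mathcal F,\mathbb P)$ be a probability space with a normal filtration $(\mathcal F_t)_{t\in[0,T]}$ (that is, right-continuous, with $\mathcal F_0$ containing every $A\in\mathcal F$ such that $\mathbb P(A)=0$), let $d,m\in\mathbb N=\{1,2,\dots\}$, let $W:[0,T]\times\Omega\to\mathbb R^m$ be an $m$-dimensional standard $(\mathcal F_t)_{t\in[0,T]}$-Brownian motion, and let $\xi:\Omega\to\mathbb R^d$ be $\mathcal F_0$-measurable with $\mathbb E[\|\xi\|^p]<\infty$ for all $p\in[1,\infty)$. Let $\mu:\mathbb R^d\to\mathbb R^d$ be continuously differentiable, let $\sigma:\mathbb R^d\to\mathbb R^{d\times m}$, and suppose that there is a real number $c\in(0,\infty)$ such that for all $x,y\in\mathbb R^d$ $$\|\mu'(x)\|\le c\,(1+\|x\|^c),\qquad \|\sigma(x)-\sigma(y)\|\le c\,\|x-y\|,\qquad \langle x-y,\mu(x)-\mu(y)\rangle\le c\,\|x-y\|^2,$$ where vectors carry the Euclidean norm and matrices the induced operator norm. For $N\in\mathbb N$ let the tamed Euler approximations $Y^N_n:\Omega\to\mathbb R^d$,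 $n\in\{0,1,\dots,N\}$, be given by $Y^N_0=\xi$ and $$Y^N_{n+1}=Y^N_n+\frac{\frac TN\,\mu(Y^N_n)}{1+\frac TN\,\|\mu(Y^N_n)\|}+\sigma(Y^N_n)\bigl(W_{(n+1)T/N}-W_{nT/N}\bigr),\qquad n\in\{0,1,\dots,N-1\}.$$ Then $$\sup_{N\in\mathbb N}\ \sup_{n\in\{0,1,\dots,N\}}\mathbb E\bigl[\|Y^N_n\|^p\bigr]<\infty\qquad\text{for all }p\in[1,\infty).$$ -/

import Mathlib

open MeasureTheory ProbabilityTheory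
open scoped ENNReal Matrix.Norms.L2Operator

/-- A filtration `(𝓕_t)_{t ∈ [0,T]}` on a probability space is *normal* if `𝓕_0` contains every
event of probability zero and the filtration is right-continuous. -/
structure IsNormalFiltration {Ω : Type*} {mΩ : MeasurableSpace Ω} (P : Measure Ω)
    {T : ℝ} (hT : 0 ≤ T) (F : Filtration (Set.Icc (0 : ℝ) T) mΩ) : Prop where
  null_mem : ∀ A : Set Ω, MeasurableSet A → P A = 0 →
    MeasurableSet[F ⟨0, Set.left_mem_Icc.mpr hT⟩] A
  rightContinuous : F.IsRightContinuous

/-- `W` is an `m`-dimensional standard `(𝓕_t)_{t ∈ [0,T]}`-Brownian motion: it is adapted, starts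
at `0`, has (almost surely) continuous paths, and for `s ≤ t` the increment `W_t - W_s` is
independent of `𝓕_s` and normally distributed with mean `0` and covariance matrix
`(t - s) • I_m`. -/
structure IsStandardBrownianMotion {Ω : Type*} {mΩ : MeasurableSpace Ω} (P : Measure Ω)
    {T : ℝ} (hT : 0 ≤ T) (F : Filtration (Set.Icc (0 : ℝ) T) mΩ) {m : ℕ}
    (W : Set.Icc (0 : ℝ) T → Ω → EuclideanSpace ℝ (Fin m)) : Prop where
  adapted : ∀ t, Measurable[F t] (W t)
  start : ∀ᵐ ω ∂P, W ⟨0, Set.left_mem_Icc.mpr hT⟩ ω = 0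
  continuous_paths : ∀ᵐ ω ∂P, Continuous fun t => W t ω
  hasLaw_increment : ∀ s t : Set.Icc (0 : ℝ) T, s ≤ t →
    HasLaw (fun ω => W t ω - W s ω)
      (multivariateGaussian 0 (((t : ℝ) - (s : ℝ)) • (1 : Matrix (Fin m) (Fin m) ℝ))) P
  indep_increment : ∀ s t : Set.Icc (0 : ℝ) T, s ≤ t →
    Indep (MeasurableSpace.comap (fun ω => W t ω - W s ω) inferInstance) (F s) P

/-- The grid time `n T / N`, as a point of `[0,T]`. The projection onto `[0,T]` has no effect for
`n ≤ N`, see `coe_gridTime`. -/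
noncomputable def gridTime {T : ℝ} (hT : 0 ≤ T) (N n : ℕ) : Set.Icc (0 : ℝ) T :=
  Set.projIcc 0 T hT ((n : ℝ) * T / (N : ℝ))

theorem coe_gridTime {T : ℝ} (hT : 0 ≤ T) {N n : ℕ} (hn : n ≤ N) :
    (gridTime hT N n : ℝ) = (n : ℝ) * T / (N : ℝ) := by
  have h : (n : ℝ) * T / (N : ℝ) ∈ Set.Icc (0 : ℝ) T := by
    refine ⟨by positivity, div_le_of_le_mul₀ (by positivity) hT ?_⟩
    rw [mul_comm T]
    exact mul_le_mul_of_nonneg_right (by exact_mod_cast hn) hT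
  rw [gridTime, Set.projIcc_of_mem hT h]

/-- The tamed Euler approximations `Y^N_n` with `N` time steps on `[0,T]`. They are meant for
`1 ≤ N` and `n ≤ N`. -/
noncomputable def tamedEuler {Ω : Type*} {T : ℝ} (hT : 0 ≤ T) {d m : ℕ}
    (μ : EuclideanSpace ℝ (Fin d) → EuclideanSpace ℝ (Fin d))
    (σ : EuclideanSpace ℝ (Fin d) → Matrix (Fin d) (Fin m) ℝ)
    (W : Set.Icc (0 : ℝ) T → Ω → EuclideanSpace ℝ (Fin m))
    (ξ : Ω → EuclideanSpace ℝ (Fin d)) (N : ℕ) : ℕ → Ω → EuclideanSpace ℝ (Fin d)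
  | 0, ω => ξ ω
  | n + 1, ω =>
    let y := tamedEuler hT μ σ W ξ N n ω
    y + (1 + T / (N : ℝ) * ‖μ y‖)⁻¹ • ((T / (N : ℝ)) • μ y)
      + Matrix.toEuclideanLin (σ y) (W (gridTime hT N (n + 1)) ω - W (gridTime hT N n) ω)

/-! With `h = T/N`, the weight `(M + ‖y‖²)^k` grows in expectation by at most a factor `exp(C h)`
per step whenever the drift raises `M + ‖y‖²` by at most a factor `1 + K h`: the noise term of order
`√h` is linear in a centred Gaussian and vanishes on integration
(`exists_lintegral_pow_add_norm_sq_le`). The one-sided bound controls the inner product with the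
drift, so only the squared tamed increment, at most `min 1 (h² ‖μ y‖²)`, matters.

On `D = {‖μ‖² ≤ N}` it is at most `h T`, so `M = 1` works and moments localized to not having left
`D` are bounded uniformly in `N`. Everywhere it is at most `1 = h N / T`, so `M = N` works and
unlocalized moments grow at most polynomially in `N` (`exists_setLIntegral_tamed_le`).

Polynomial growth of `μ` makes leaving `D` costly: at the exit time, `N` is bounded by a polynomial
in `‖Y‖`, whose localized moments are bounded. Exit probabilities thus decay faster than any power
of `N`, which beats the polynomial growth (`lintegral_le_of_localized`). -/

/-! ### Pointwise one-step estimate -/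

/-- A Bernoulli-type upper bound for powers with quadratic remainder. -/
theorem one_add_pow_le_of_neg_one_le {a : ℝ} (ha : -1 ≤ a) (k : ℕ) :
    (1 + a) ^ k ≤ 1 + k * a + k ^ 2 * (a ^ 2 * (1 + |a|) ^ k) := by
  induction k with
  | zero => simp
  | succ k ih =>
    have h1 : (1 + a) ^ (k + 1) ≤
        (1 + k * a + k ^ 2 * (a ^ 2 * (1 + |a|) ^ k)) * (1 + a) := by
      rw [pow_succ]
      exact mul_le_mul_of_nonneg_right ih (by linarith)
    have h2 : (1 + |a|) ^ k * (1 + a) ≤ (1 + |a|) ^ (k + 1) := by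
      rw [pow_succ]
      exact mul_le_mul_of_nonneg_left (by linarith [le_abs_self a]) (by positivity)
    have h3 : (1 : ℝ) ≤ (1 + |a|) ^ (k + 1) := one_le_pow₀ (by linarith [abs_nonneg a])
    have h4 := mul_le_mul_of_nonneg_left h2 (by positivity : 0 ≤ (k : ℝ) ^ 2 * a ^ 2)
    have h5 := mul_le_mul_of_nonneg_left h3 (by positivity : 0 ≤ (k : ℝ) * a ^ 2)
    have h6 : 0 ≤ ((k : ℝ) + 1) * (a ^ 2 * (1 + |a|) ^ (k + 1)) := by positivity
    push_cast
    nlinarith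

open Polynomial in
/-- The remainder polynomial of the one-step moment estimate. -/
noncomputable def stepRemainder (T Λ : ℝ) (k : ℕ) : ℝ[X] :=
  let ψ : ℝ[X] := C (2 * Λ) * X + C (√T * Λ ^ 2) * X ^ 2
  C (k * Λ ^ 2) * X ^ 2 + C ((k : ℝ) ^ 2) * (ψ ^ 2 * (1 + C √T * ψ) ^ k)

/-- Only the term linear in `q` keeps the order `√h`; all else is `h` times a polynomial in `s`. In
the application `q` is linear in the Gaussian variable and `s` is its norm. -/
theorem pow_add_norm_sq_le {F : Type*} [NormedAddCommGroup F] [InnerProductSpace ℝ F]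
    {T Λ h M r s : ℝ} (k : ℕ) {z q : F} (hh : 0 ≤ h) (hhT : h ≤ T) (hM : 0 ≤ M) (hr : 0 < r)
    (hs : 0 ≤ s) (hΛ : 0 ≤ Λ) (hz : M + ‖z‖ ^ 2 ≤ r ^ 2) (hq : ‖q‖ ≤ Λ * r * s) :
    (M + ‖z + √h • q‖ ^ 2) ^ k ≤
      (r ^ 2) ^ k * (1 + 2 * k * √h / r ^ 2 * inner ℝ z q + h * (stepRemainder T Λ k).eval s) := by
  set ψ : ℝ := 2 * Λ * s + √T * Λ ^ 2 * s ^ 2 with hψ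
  have hψ0 : 0 ≤ ψ := by positivity
  have hr2 : 0 < r ^ 2 := by positivity
  have hsq : √h ^ 2 = h := Real.sq_sqrt hh
  have hsT : √h ≤ √T := Real.sqrt_le_sqrt hhT
  have hzr : ‖z‖ ≤ r := by
    refine le_of_sq_le_sq ?_ hr.le
    linarith
  have hq2 : ‖q‖ ^ 2 ≤ r ^ 2 * (Λ ^ 2 * s ^ 2) := by
    calc ‖q‖ ^ 2 ≤ (Λ * r * s) ^ 2 := by gcongr
      _ = _ := by ring
  have hzq : |inner ℝ z q| ≤ r ^ 2 * (Λ * s) := by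
    calc |inner ℝ z q| ≤ ‖z‖ * ‖q‖ := abs_real_inner_le_norm z q
      _ ≤ r * (Λ * r * s) := by gcongr
      _ = _ := by ring
  -- The relative increment satisfies `|a| ≤ √h ψ`, so the quadratic Bernoulli remainder is of order
  -- `h`.
  set a : ℝ := (2 * √h * inner ℝ z q + h * ‖q‖ ^ 2) / r ^ 2 with ha
  have har : r ^ 2 * a = 2 * √h * inner ℝ z q + h * ‖q‖ ^ 2 := by
    rw [ha]; field_simp
  have hexp : M + ‖z + √h • q‖ ^ 2 = M + ‖z‖ ^ 2 + r ^ 2 * a := by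
    rw [har, norm_add_sq_real, inner_smul_right, norm_smul, mul_pow, Real.norm_eq_abs, sq_abs, hsq]
    ring
  have hle : M + ‖z + √h • q‖ ^ 2 ≤ r ^ 2 * (1 + a) := by rw [hexp]; linarith
  have ha1 : 0 ≤ 1 + a := by
    have : 0 ≤ r ^ 2 * (1 + a) := le_trans (by positivity) hle
    exact nonneg_of_mul_nonneg_right this hr2
  have habs : |a| ≤ √h * ψ := by
    rw [ha, abs_div, abs_of_pos hr2, div_le_iff₀ hr2]
    calc |2 * √h * inner ℝ z q + h * ‖q‖ ^ 2|
        ≤ |2 * √h * inner ℝ z q| + |h * ‖q‖ ^ 2| := abs_add_le _ _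
      _ = 2 * √h * |inner ℝ z q| + √h * √h * ‖q‖ ^ 2 := by
        rw [abs_mul, abs_of_nonneg (by positivity : 0 ≤ 2 * √h),
          abs_of_nonneg (by positivity : 0 ≤ h * ‖q‖ ^ 2), Real.mul_self_sqrt hh]
      _ ≤ 2 * √h * (r ^ 2 * (Λ * s)) + √h * √T * (r ^ 2 * (Λ ^ 2 * s ^ 2)) := by gcongr
      _ = _ := by rw [hψ]; ring
  have ha2 : a ^ 2 ≤ h * ψ ^ 2 := by
    calc a ^ 2 = |a| ^ 2 := (sq_abs a).symm
      _ ≤ (√h * ψ) ^ 2 := by gcongr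
      _ = _ := by rw [mul_pow, hsq]
  have haT : |a| ≤ √T * ψ := habs.trans (by gcongr)
  have hka : k * a ≤ 2 * k * √h / r ^ 2 * inner ℝ z q + h * (k * Λ ^ 2 * s ^ 2) := by
    have : a ≤ 2 * √h / r ^ 2 * inner ℝ z q + h * (Λ ^ 2 * s ^ 2) := by
      have h1 : a = 2 * √h / r ^ 2 * inner ℝ z q + h * (‖q‖ ^ 2 / r ^ 2) := by rw [ha]; ring
      rw [h1]
      gcongr
      rw [div_le_iff₀ hr2]
      linarith
    calc k * a ≤ k * (2 * √h / r ^ 2 * inner ℝ z q + h * (Λ ^ 2 * s ^ 2)) := by gcongr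
      _ = _ := by ring
  have heval : (stepRemainder T Λ k).eval s =
      k * Λ ^ 2 * s ^ 2 + k ^ 2 * (ψ ^ 2 * (1 + √T * ψ) ^ k) := by
    simp [stepRemainder, hψ]
  calc (M + ‖z + √h • q‖ ^ 2) ^ k ≤ (r ^ 2 * (1 + a)) ^ k := by gcongr
    _ = (r ^ 2) ^ k * (1 + a) ^ k := mul_pow _ _ _
    _ ≤ (r ^ 2) ^ k * (1 + k * a + k ^ 2 * (a ^ 2 * (1 + |a|) ^ k)) := by
      gcongr
      exact one_add_pow_le_of_neg_one_le (by linarith) k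
    _ ≤ (r ^ 2) ^ k * (1 + (2 * k * √h / r ^ 2 * inner ℝ z q + h * (k * Λ ^ 2 * s ^ 2)) +
        k ^ 2 * (h * ψ ^ 2 * (1 + √T * ψ) ^ k)) := by
      gcongr
    _ = _ := by rw [heval]; ring

/-! ### Integrating the one-step estimate over Gaussian noise -/

section Gaussian

variable {E : Type*} [NormedAddCommGroup E] [InnerProductSpace ℝ E] [FiniteDimensional ℝ E]
  [MeasurableSpace E] [BorelSpace E]

theorem integrable_eval_norm_stdGaussian (p : Polynomial ℝ) :
    Integrable (fun x : E => p.eval ‖x‖) (stdGaussian E) := by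
  induction p using Polynomial.induction_on' with
  | add p q hp hq =>
    simp only [Polynomial.eval_add]
    exact hp.add hq
  | monomial n a =>
    simp only [Polynomial.eval_monomial]
    exact ((IsGaussian.memLp_id (stdGaussian E) n (by simp)).integrable_norm_pow').const_mul a

/-- Here `z` is the point after the drift and `w` the weight before it. Uniformity of `C` in `M` and
`h` allows both `M = 1` and `M = N`. -/
theorem exists_lintegral_pow_add_norm_sq_le {F : Type*} [NormedAddCommGroup F]
    [InnerProductSpace ℝ F] (k : ℕ) {T K Λ : ℝ} (hK : 0 ≤ K) (hΛ : 0 ≤ Λ) :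
    ∃ C : ℝ, 0 ≤ C ∧ ∀ (h M w : ℝ) (z : F) (S : E →L[ℝ] F), 0 ≤ h → h ≤ T → 0 ≤ M → 0 < w →
      M + ‖z‖ ^ 2 ≤ (1 + K * h) * w → ‖S‖ ≤ Λ * √w →
      ∫⁻ x, ENNReal.ofReal ((M + ‖z + S (√h • x)‖ ^ 2) ^ k) ∂(stdGaussian E) ≤
        ENNReal.ofReal (Real.exp (C * h)) * ENNReal.ofReal (w ^ k) := by
  set J : ℝ := ∫ x : E, (stepRemainder T Λ k).eval ‖x‖ ∂(stdGaussian E) with hJ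
  -- `k * K` pays for the drift factor `(1 + K h)^k`, and `|J|` for the mean of the remainder
  -- polynomial.
  refine ⟨k * K + |J|, by positivity, fun h M w z S hh hhT hM hw hz hS => ?_⟩
  set r : ℝ := √((1 + K * h) * w) with hrdef
  have hKh : 1 ≤ 1 + K * h := by nlinarith
  have hw' : 0 < (1 + K * h) * w := by positivity
  have hr : 0 < r := Real.sqrt_pos.2 hw'
  have hr2 : r ^ 2 = (1 + K * h) * w := Real.sq_sqrt hw'.le
  have hwr : √w ≤ r := Real.sqrt_le_sqrt (by nlinarith)
  set L : StrongDual ℝ E := (innerSL ℝ z).comp S with hL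
  have hLint : Integrable L (stdGaussian E) := L.integrable_comp IsGaussian.integrable_id
  have hRint := integrable_eval_norm_stdGaussian (E := E) (stepRemainder T Λ k)
  set f : E → ℝ := fun x => (r ^ 2) ^ k * (1 + 2 * k * √h / r ^ 2 * L x +
    h * (stepRemainder T Λ k).eval ‖x‖) with hf
  have hpt : ∀ x : E, (M + ‖z + S (√h • x)‖ ^ 2) ^ k ≤ f x := by
    intro x
    rw [map_smul]
    refine pow_add_norm_sq_le k hh hhT hM hr (norm_nonneg x) hΛ (hz.trans_eq hr2.symm) ?_
    calc ‖S x‖ ≤ ‖S‖ * ‖x‖ := S.le_opNorm x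
      _ ≤ Λ * r * ‖x‖ := by gcongr; exact hS.trans (by gcongr)
  have hlin : Integrable (fun x => 1 + 2 * k * √h / r ^ 2 * L x) (stdGaussian E) :=
    (integrable_const 1).add (hLint.const_mul _)
  have hfint : Integrable f (stdGaussian E) := (hlin.add (hRint.const_mul h)).const_mul _
  have hfI : ∫ x, f x ∂(stdGaussian E) = (r ^ 2) ^ k * (1 + h * J) := by
    rw [hf, integral_const_mul, integral_add hlin (hRint.const_mul h), integral_add (integrable_const 1) (hLint.const_mul _),
      integral_const_mul, integral_const_mul, integral_strongDual_stdGaussian]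
    simp [hJ]
  calc ∫⁻ x, ENNReal.ofReal ((M + ‖z + S (√h • x)‖ ^ 2) ^ k) ∂(stdGaussian E)
      ≤ ∫⁻ x, ENNReal.ofReal (f x) ∂(stdGaussian E) :=
        lintegral_mono fun x => ENNReal.ofReal_le_ofReal (hpt x)
    _ = ENNReal.ofReal (∫ x, f x ∂(stdGaussian E)) :=
        (ofReal_integral_eq_lintegral_ofReal hfint
          (.of_forall fun x => le_trans (by positivity) (hpt x))).symm
    _ ≤ ENNReal.ofReal (Real.exp ((k * K + |J|) * h) * w ^ k) := by
        apply ENNReal.ofReal_le_ofReal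
        rw [hfI, hr2, mul_pow]
        have h1 : (1 + K * h) ^ k ≤ Real.exp (k * K * h) := by
          rw [mul_assoc, Real.exp_nat_mul]
          gcongr
          linarith [Real.add_one_le_exp (K * h)]
        have h2 : 1 + h * J ≤ Real.exp (|J| * h) := by
          have := Real.add_one_le_exp (|J| * h)
          nlinarith [le_abs_self J]
        calc (1 + K * h) ^ k * w ^ k * (1 + h * J)
            ≤ (1 + K * h) ^ k * w ^ k * Real.exp (|J| * h) := by gcongr
          _ ≤ Real.exp (k * K * h) * w ^ k * Real.exp (|J| * h) := by gcongr
          _ = _ := by rw [add_mul, Real.exp_add]; ring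
    _ = _ := ENNReal.ofReal_mul (Real.exp_nonneg _)

end Gaussian

/-! ### Independent increments and iteration of the one-step bound -/

theorem multivariateGaussian_zero_smul_one {m : ℕ} {h : ℝ} (hh : 0 ≤ h) :
    multivariateGaussian 0 (h • (1 : Matrix (Fin m) (Fin m) ℝ)) =
      (stdGaussian (EuclideanSpace ℝ (Fin m))).map (fun x => √h • x) := by
  apply Measure.ext_of_charFun
  ext t
  have hpos : (h • (1 : Matrix (Fin m) (Fin m) ℝ)).PosSemidef := Matrix.PosSemidef.one.smul hh
  rw [charFun_multivariateGaussian hpos, charFun_map_smul, charFun_stdGaussian, norm_smul,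
    ← Complex.ofReal_pow, mul_pow, Real.norm_eq_abs, sq_abs, Real.sq_sqrt hh,
    EuclideanSpace.real_norm_sq_eq]
  have hdot : t.ofLp ⬝ᵥ (h • (1 : Matrix (Fin m) (Fin m) ℝ)).mulVec t.ofLp =
      h * ∑ i, t.ofLp i ^ 2 := by
    simp [Matrix.smul_mulVec, dotProduct, pow_two, Finset.mul_sum, mul_left_comm]
  rw [hdot, inner_zero_right]
  simp [neg_div]

/-- By independence the joint law is a product, so Tonelli lets `X` be frozen while `G` is
integrated out; this replaces conditional expectations. -/
theorem lintegral_le_of_indepFun {Ω β γ : Type*} {mΩ : MeasurableSpace Ω} [MeasurableSpace β]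
    [MeasurableSpace γ] {P : Measure Ω} [IsProbabilityMeasure P] {X : Ω → β} {G : Ω → γ}
    (hX : Measurable X) (hG : Measurable G) (hXG : IndepFun X G P) {f : β × γ → ℝ≥0∞}
    (hf : Measurable f) {g : β → ℝ≥0∞} (hg : Measurable g)
    (hfg : ∀ b, ∫⁻ x, f (b, x) ∂(P.map G) ≤ g b) :
    ∫⁻ ω, f (X ω, G ω) ∂P ≤ ∫⁻ ω, g (X ω) ∂P := by
  have := Measure.isProbabilityMeasure_map (μ := P) hG.aemeasurable
  calc ∫⁻ ω, f (X ω, G ω) ∂P = ∫⁻ p, f p ∂(P.map fun ω => (X ω, G ω)) :=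
        (lintegral_map hf (hX.prodMk hG)).symm
    _ = ∫⁻ b, ∫⁻ x, f (b, x) ∂(P.map G) ∂(P.map X) := by
        rw [(indepFun_iff_map_prod_eq_prod_map_map hX.aemeasurable hG.aemeasurable).1 hXG,
          lintegral_prod _ hf.aemeasurable]
    _ ≤ ∫⁻ b, g b ∂(P.map X) := lintegral_mono hfg
    _ = ∫⁻ ω, g (X ω) ∂P := lintegral_map hg hX

/-- The event that `Y` stays in `D` strictly before time `n`. -/
def staysIn {Ω E : Type*} (Y : ℕ → Ω → E) (D : Set E) (n : ℕ) : Set Ω := {ω | ∀ j < n, Y j ω ∈ D}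

theorem staysIn_succ {Ω E : Type*} (Y : ℕ → Ω → E) (D : Set E) (n : ℕ) :
    staysIn Y D (n + 1) = staysIn Y D n ∩ Y n ⁻¹' D := by
  ext ω
  simp only [staysIn, Set.mem_ofPred_eq, Nat.forall_lt_succ_right, Set.mem_inter_iff,
    Set.mem_preimage]

theorem measurableSet_staysIn {Ω E : Type*} {m : MeasurableSpace Ω} [MeasurableSpace E]
    {Y : ℕ → Ω → E} {D : Set E} {n : ℕ} (hY : ∀ j < n, Measurable (Y j)) (hD : MeasurableSet D) :
    MeasurableSet (staysIn Y D n) := by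
  have : staysIn Y D n = ⋂ j, ⋂ (_ : j < n), Y j ⁻¹' D := by ext; simp [staysIn]
  rw [this]
  exact MeasurableSet.iInter fun j => MeasurableSet.iInter fun hj => hY j hj hD

section EulerScheme

variable {Ω E E' : Type*} {mΩ : MeasurableSpace Ω}
  [NormedAddCommGroup E] [InnerProductSpace ℝ E] [FiniteDimensional ℝ E]
  [MeasurableSpace E] [BorelSpace E]
  [NormedAddCommGroup E'] [InnerProductSpace ℝ E'] [FiniteDimensional ℝ E']
  [MeasurableSpace E'] [BorelSpace E']

/-- `Y` is an explicit one-step scheme `Y (n+1) = Y n + b (Y n) + S (Y n) (G n)` with `N` steps,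
driven by centred Gaussian increments `G n` with covariance `h • 1` which are independent of the
past. -/
structure IsEulerScheme (P : Measure Ω) (𝓖 : Filtration ℕ mΩ) (N : ℕ) (h : ℝ) (b : E → E)
    (S : E → E' →L[ℝ] E) (G : ℕ → Ω → E') (Y : ℕ → Ω → E) : Prop where
  measurable_drift : Measurable b
  continuous_diffusion : Continuous S
  measurable_increment : ∀ n, Measurable (G n)
  adapted : ∀ n, Measurable[𝓖 n] (Y n)
  indep : ∀ n < N, Indep (MeasurableSpace.comap (G n) inferInstance) (𝓖 n) P
  law : ∀ n < N, P.map (G n) = (stdGaussian E').map (fun x => √h • x)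
  step : ∀ n ω, Y (n + 1) ω = Y n ω + b (Y n ω) + S (Y n ω) (G n ω)

namespace IsEulerScheme

variable {P : Measure Ω} {𝓖 : Filtration ℕ mΩ} {N : ℕ} {h : ℝ} {b : E → E}
  {S : E → E' →L[ℝ] E} {G : ℕ → Ω → E'} {Y : ℕ → Ω → E}

omit [FiniteDimensional ℝ E] [BorelSpace E] [BorelSpace E'] in
theorem measurable (hY : IsEulerScheme P 𝓖 N h b S G Y) (n : ℕ) : Measurable (Y n) :=
  (hY.adapted n).mono (𝓖.le n) le_rfl

theorem setLIntegral_step_le [IsProbabilityMeasure P] (hY : IsEulerScheme P 𝓖 N h b S G Y)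
    {D : Set E} (hD : MeasurableSet D) {k : ℕ} {M A : ℝ}
    (hstep : ∀ y ∈ D, ∫⁻ x, ENNReal.ofReal ((M + ‖y + b y + S y (√h • x)‖ ^ 2) ^ k)
      ∂(stdGaussian E') ≤ ENNReal.ofReal A * ENNReal.ofReal ((M + ‖y‖ ^ 2) ^ k))
    {n : ℕ} (hn : n < N) :
    ∫⁻ ω in staysIn Y D (n + 1), ENNReal.ofReal ((M + ‖Y (n + 1) ω‖ ^ 2) ^ k) ∂P ≤
      ENNReal.ofReal A * ∫⁻ ω in staysIn Y D n, ENNReal.ofReal ((M + ‖Y n ω‖ ^ 2) ^ k) ∂P := by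
  -- The past event enters as an extra coordinate: the pair `(Y n, a)` is `𝓖 n`-measurable, hence
  -- independent of `G n`.
  set a : Ω → ℝ≥0∞ := (staysIn Y D n).indicator 1 with ha
  have hameas : Measurable[𝓖 n] a :=
    measurable_const.indicator (measurableSet_staysIn
      (fun j hj => (hY.adapted j).mono (𝓖.mono hj.le) le_rfl) hD)
  have hXmeas : Measurable[𝓖 n] fun ω => (Y n ω, a ω) := (hY.adapted n).prodMk hameas
  have hX : Measurable fun ω => (Y n ω, a ω) := hXmeas.mono (𝓖.le n) le_rfl
  have hind : IndepFun (fun ω => (Y n ω, a ω)) (G n) P := by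
    rw [IndepFun_iff_Indep]
    exact (indep_of_indep_of_le_right (hY.indep n hn) hXmeas.comap_le).symm
  have hSmeas : Measurable fun p : (E × ℝ≥0∞) × E' => S p.1.1 p.2 := by
    have hcont : Continuous fun p : E × E' => S p.1 p.2 :=
      (hY.continuous_diffusion.comp continuous_fst).clm_apply continuous_snd
    exact hcont.measurable.comp (by fun_prop : Measurable fun p : (E × ℝ≥0∞) × E' => (p.1.1, p.2))
  have hb := hY.measurable_drift
  have hDind : Measurable (D.indicator (1 : E → ℝ≥0∞)) := measurable_const.indicator hD
  set f : (E × ℝ≥0∞) × E' → ℝ≥0∞ := fun p => p.1.2 * (D.indicator 1 p.1.1 *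
    ENNReal.ofReal ((M + ‖p.1.1 + b p.1.1 + S p.1.1 p.2‖ ^ 2) ^ k)) with hf
  set g : E × ℝ≥0∞ → ℝ≥0∞ := fun p =>
    p.2 * (ENNReal.ofReal A * ENNReal.ofReal ((M + ‖p.1‖ ^ 2) ^ k)) with hg
  have hfm : Measurable f := by
    have h1 : Measurable fun p : (E × ℝ≥0∞) × E' => D.indicator (1 : E → ℝ≥0∞) p.1.1 :=
      hDind.comp (by fun_prop)
    have h2 : Measurable fun p : (E × ℝ≥0∞) × E' => p.1.1 + b p.1.1 + S p.1.1 p.2 :=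
      Measurable.add (by fun_prop) hSmeas
    exact (measurable_snd.comp measurable_fst).mul
      (h1.mul (((h2.norm.pow_const 2).const_add M).pow_const k).ennreal_ofReal)
  have hgm : Measurable g := by rw [hg]; fun_prop
  have hfg : ∀ p, ∫⁻ x, f (p, x) ∂(P.map (G n)) ≤ g p := by
    rintro ⟨y, α⟩
    rw [hY.law n hn, lintegral_map (f := fun x => f ((y, α), x)) (hfm.comp measurable_prodMk_left) (by fun_prop)]
    by_cases hy : y ∈ D
    · simp only [hf, hg, Set.indicator_of_mem hy, Pi.one_apply, one_mul]
      rw [lintegral_const_mul]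
      · gcongr
        exact hstep y hy
      · fun_prop
    · simp [hf, hy]
  have hkey := lintegral_le_of_indepFun hX (hY.measurable_increment n) hind hfm hgm hfg
  calc ∫⁻ ω in staysIn Y D (n + 1), ENNReal.ofReal ((M + ‖Y (n + 1) ω‖ ^ 2) ^ k) ∂P
      = ∫⁻ ω, f ((Y n ω, a ω), G n ω) ∂P := by
        rw [← lintegral_indicator (measurableSet_staysIn (fun j _ => hY.measurable j) hD)]
        congr 1 with ω
        rw [staysIn_succ, ← Set.indicator_indicator]
        by_cases h1 : ω ∈ staysIn Y D n <;> by_cases h2 : Y n ω ∈ D <;>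
          simp [hf, ha, h1, h2, hY.step]
    _ ≤ ∫⁻ ω, g (Y n ω, a ω) ∂P := hkey
    _ = ENNReal.ofReal A *
          ∫⁻ ω in staysIn Y D n, ENNReal.ofReal ((M + ‖Y n ω‖ ^ 2) ^ k) ∂P := by
        have hYn := hY.measurable n
        rw [← lintegral_const_mul _ (by fun_prop),
          ← lintegral_indicator (measurableSet_staysIn (fun j _ => hY.measurable j) hD)]
        congr 1 with ω
        by_cases h1 : ω ∈ staysIn Y D n <;> simp [hg, ha, h1]

theorem setLIntegral_le [IsProbabilityMeasure P] (hY : IsEulerScheme P 𝓖 N h b S G Y)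
    {D : Set E} (hD : MeasurableSet D) {k : ℕ} {M C : ℝ}
    (hstep : ∀ y ∈ D, ∫⁻ x, ENNReal.ofReal ((M + ‖y + b y + S y (√h • x)‖ ^ 2) ^ k)
      ∂(stdGaussian E') ≤ ENNReal.ofReal (Real.exp C) * ENNReal.ofReal ((M + ‖y‖ ^ 2) ^ k))
    {n : ℕ} (hn : n ≤ N) :
    ∫⁻ ω in staysIn Y D n, ENNReal.ofReal ((M + ‖Y n ω‖ ^ 2) ^ k) ∂P ≤
      ENNReal.ofReal (Real.exp (n * C)) * ∫⁻ ω, ENNReal.ofReal ((M + ‖Y 0 ω‖ ^ 2) ^ k) ∂P := by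
  induction n with
  | zero => simpa using setLIntegral_le_lintegral _ _
  | succ n ih =>
    refine (hY.setLIntegral_step_le hD hstep hn).trans ?_
    grw [ih (by omega)]
    rw [← mul_assoc, ← ENNReal.ofReal_mul (Real.exp_nonneg _), ← Real.exp_add]
    push_cast
    rw [add_mul, one_mul, add_comm C]

end IsEulerScheme

end EulerScheme

/-! ### Removing the localization via the first exit time -/

theorem exists_mem_staysIn_not_mem {Ω E : Type*} {Y : ℕ → Ω → E} {D : Set E} {n : ℕ} {ω : Ω}
    (hω : ω ∉ staysIn Y D n) : ∃ j < n, ω ∈ staysIn Y D j ∧ Y j ω ∉ D := by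
  classical
  have h : ∃ j, j < n ∧ Y j ω ∉ D := by simpa [staysIn] using hω
  refine ⟨Nat.find h, (Nat.find_spec h).1, fun i hi => ?_, (Nat.find_spec h).2⟩
  by_contra hi'
  exact Nat.find_min h hi ⟨hi.trans (Nat.find_spec h).1, hi'⟩

/-- Moments of `Y` are controlled by the moments localized to the event of having stayed in `D`,
together with moments that may grow polynomially in `N`. -/
theorem lintegral_le_of_localized {Ω E : Type*} {mΩ : MeasurableSpace Ω} {P : Measure Ω}
    [NormedAddCommGroup E] [MeasurableSpace E] [BorelSpace E]
    {Y : ℕ → Ω → E} (hY : ∀ n, Measurable (Y n)) {D : Set E} (hD : MeasurableSet D)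
    {N : ℕ} (hN : 1 ≤ N) {κ : ℝ} (hκ : 0 ≤ κ) {s k : ℕ}
    (hDκ : ∀ y ∉ D, (N : ℝ) ≤ κ * (1 + ‖y‖ ^ 2) ^ s) {C₁ C₂ C₃ : ℝ≥0∞}
    (h₁ : ∀ n ≤ N, ∫⁻ ω in staysIn Y D n, ENNReal.ofReal ((1 + ‖Y n ω‖ ^ 2) ^ k) ∂P ≤ C₁)
    (h₂ : ∀ n ≤ N, ∫⁻ ω, ENNReal.ofReal ((N + ‖Y n ω‖ ^ 2) ^ (2 * k)) ∂P ≤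
      ENNReal.ofReal ((N : ℝ) ^ (2 * k)) * C₂)
    (h₃ : ∀ n ≤ N, ∫⁻ ω in staysIn Y D n,
      ENNReal.ofReal ((1 + ‖Y n ω‖ ^ 2) ^ (s * (2 * k + 1))) ∂P ≤ C₃)
    {n : ℕ} (hn : n ≤ N) :
    ∫⁻ ω, ENNReal.ofReal ((1 + ‖Y n ω‖ ^ 2) ^ k) ∂P ≤
      C₁ + C₂ + ENNReal.ofReal (κ ^ (2 * k + 1)) * C₃ := by
  have hN0 : (0 : ℝ) < N := by exact_mod_cast hN
  have hN1 : (1 : ℝ) ≤ N := by exact_mod_cast hN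
  have hA : ∀ j, MeasurableSet (staysIn Y D j) := fun j =>
    measurableSet_staysIn (fun i _ => hY i) hD
  set f₁ : Ω → ℝ≥0∞ := (staysIn Y D n).indicator
    fun ω => ENNReal.ofReal ((1 + ‖Y n ω‖ ^ 2) ^ k) with hf₁
  set f₂ : Ω → ℝ≥0∞ := fun ω => ENNReal.ofReal (((N : ℝ) ^ (2 * k))⁻¹) *
    ENNReal.ofReal ((N + ‖Y n ω‖ ^ 2) ^ (2 * k)) with hf₂
  set f₃ : ℕ → Ω → ℝ≥0∞ := fun j => (staysIn Y D j).indicator fun ω =>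
    ENNReal.ofReal (κ ^ (2 * k + 1) / N) *
      ENNReal.ofReal ((1 + ‖Y j ω‖ ^ 2) ^ (s * (2 * k + 1))) with hf₃
  have hm₁ : Measurable f₁ := by
    have := hY n
    exact Measurable.indicator (by fun_prop) (hA n)
  have hm₂ : Measurable f₂ := by
    have := hY n
    rw [hf₂]
    fun_prop
  have hm₃ : ∀ j, Measurable (f₃ j) := fun j => by
    have := hY j
    exact Measurable.indicator (by fun_prop) (hA j)
  have hpt : ∀ ω, ENNReal.ofReal ((1 + ‖Y n ω‖ ^ 2) ^ k) ≤
      f₁ ω + f₂ ω + ∑ j ∈ Finset.range n, f₃ j ω := by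
    intro ω
    by_cases hω : ω ∈ staysIn Y D n
    · rw [hf₁, Set.indicator_of_mem hω, add_assoc]
      exact le_self_add
    · obtain ⟨j, hj, hωj, hYj⟩ := exists_mem_staysIn_not_mem hω
      set x : ℝ := N + ‖Y n ω‖ ^ 2 with hx
      set a : ℝ := (N : ℝ) ^ (2 * k) with ha
      have ha0 : 0 < a := by positivity
      have h1 : (1 + ‖Y n ω‖ ^ 2) ^ k ≤ x ^ k := by rw [hx]; gcongr
      -- Young's inequality, weighted so that `a⁻¹` cancels the factor `N^(2k)` in `h₂`.
      have h2 : x ^ k ≤ a⁻¹ * x ^ (2 * k) + a := by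
        have h3 : x ^ (2 * k) = (x ^ k) ^ 2 := by rw [mul_comm, pow_mul]
        rw [h3, inv_mul_eq_div, div_add' _ _ _ ha0.ne', le_div_iff₀ ha0]
        nlinarith [sq_nonneg (x ^ k - a), sq_nonneg (x ^ k + a)]
      -- The power `2k + 1` instead of `2k` leaves a factor `1/N`, which pays for the sum over at
      -- most `N` exit times.
      have h4 : a ≤ κ ^ (2 * k + 1) / N * (1 + ‖Y j ω‖ ^ 2) ^ (s * (2 * k + 1)) := by
        have h5 : (N : ℝ) ^ (2 * k + 1) ≤ (κ * (1 + ‖Y j ω‖ ^ 2) ^ s) ^ (2 * k + 1) := by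
          gcongr
          exact hDκ _ hYj
        rw [mul_pow, ← pow_mul] at h5
        rw [div_mul_eq_mul_div, le_div_iff₀ hN0, ha, ← pow_succ]
        exact h5
      calc ENNReal.ofReal ((1 + ‖Y n ω‖ ^ 2) ^ k)
          ≤ ENNReal.ofReal (a⁻¹ * x ^ (2 * k) +
              κ ^ (2 * k + 1) / N * (1 + ‖Y j ω‖ ^ 2) ^ (s * (2 * k + 1))) :=
            ENNReal.ofReal_le_ofReal (by linarith)
        _ = f₂ ω + f₃ j ω := by
            rw [ENNReal.ofReal_add (by positivity) (by positivity),
              ENNReal.ofReal_mul (by positivity), ENNReal.ofReal_mul (by positivity), hf₃]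
            simp only [Set.indicator_of_mem hωj, hf₂, hx]
        _ ≤ f₁ ω + f₂ ω + ∑ j ∈ Finset.range n, f₃ j ω := by
            gcongr
            · exact le_add_self
            · exact Finset.single_le_sum (f := fun j => f₃ j ω) (fun _ _ => zero_le)
                (Finset.mem_range.2 hj)
  have hi₁ : ∫⁻ ω, f₁ ω ∂P ≤ C₁ := by
    rw [hf₁, lintegral_indicator (hA n)]
    exact h₁ n hn
  have hi₂ : ∫⁻ ω, f₂ ω ∂P ≤ C₂ := by
    have := hY n
    rw [hf₂, lintegral_const_mul _ (by fun_prop)]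
    grw [h₂ n hn]
    rw [← mul_assoc, ← ENNReal.ofReal_mul (by positivity), inv_mul_cancel₀ (by positivity)]
    simp
  have hi₃ : ∀ j < n, ∫⁻ ω, f₃ j ω ∂P ≤ ENNReal.ofReal (κ ^ (2 * k + 1) / N) * C₃ := by
    intro j hj
    have := hY j
    rw [hf₃, lintegral_indicator (hA j), lintegral_const_mul _ (by fun_prop)]
    grw [h₃ j (by omega)]
  calc ∫⁻ ω, ENNReal.ofReal ((1 + ‖Y n ω‖ ^ 2) ^ k) ∂P
      ≤ ∫⁻ ω, (f₁ ω + f₂ ω + ∑ j ∈ Finset.range n, f₃ j ω) ∂P := lintegral_mono hpt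
    _ = ∫⁻ ω, f₁ ω ∂P + ∫⁻ ω, f₂ ω ∂P + ∑ j ∈ Finset.range n, ∫⁻ ω, f₃ j ω ∂P := by
        rw [lintegral_add_left (f := fun ω => f₁ ω + f₂ ω) (hm₁.add hm₂), lintegral_add_left hm₁,
          lintegral_finsetSum _ fun j _ => hm₃ j]
    _ ≤ C₁ + C₂ + ∑ j ∈ Finset.range n, ENNReal.ofReal (κ ^ (2 * k + 1) / N) * C₃ := by
        gcongr with j hj
        exact hi₃ j (Finset.mem_range.1 hj)
    _ = C₁ + C₂ + ENNReal.ofReal (n * (κ ^ (2 * k + 1) / N)) * C₃ := by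
        rw [Finset.sum_const, Finset.card_range, nsmul_eq_mul, ENNReal.ofReal_mul (by positivity),
          ENNReal.ofReal_natCast, mul_assoc]
    _ ≤ C₁ + C₂ + ENNReal.ofReal (κ ^ (2 * k + 1)) * C₃ := by
        gcongr
        rw [mul_div_assoc', div_le_iff₀ hN0, mul_comm]
        gcongr

/-! ### Growth of the drift and of its tamed increment -/

section TamedDrift

variable {E : Type*} [NormedAddCommGroup E] [InnerProductSpace ℝ E]

/-- The increment of the tamed drift over a time step of length `h`. -/
noncomputable def tamedDrift (μ : E → E) (h : ℝ) (y : E) : E := (1 + h * ‖μ y‖)⁻¹ • (h • μ y)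

theorem inner_self_le_of_oneSided {μ : E → E} {c : ℝ} (hc : 0 ≤ c)
    (hμ : ∀ x y, inner ℝ (x - y) (μ x - μ y) ≤ c * ‖x - y‖ ^ 2) (y : E) :
    inner ℝ y (μ y) ≤ (c + ‖μ 0‖) * (1 + ‖y‖ ^ 2) := by
  have h1 := hμ y 0
  rw [sub_zero, inner_sub_right] at h1
  have h2 : inner ℝ y (μ 0) ≤ ‖y‖ * ‖μ 0‖ := real_inner_le_norm _ _
  have h3 : ‖y‖ ≤ 1 + ‖y‖ ^ 2 := by nlinarith [sq_nonneg (‖y‖ - 1)]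
  have h4 := mul_le_mul_of_nonneg_right h3 (norm_nonneg (μ 0))
  nlinarith

/-- Taming multiplies `h • μ y` by a factor in `(0, 1]`, which preserves the one-sided bound since
its right side is nonnegative. Both entries of the minimum are needed: one inside `D`, the other
globally. -/
theorem norm_add_tamedDrift_sq_le {μ : E → E} {h K : ℝ} (hh : 0 ≤ h) (hK : 0 ≤ K) {y : E}
    (hy : inner ℝ y (μ y) ≤ K * (1 + ‖y‖ ^ 2)) :
    ‖y + tamedDrift μ h y‖ ^ 2 ≤
      ‖y‖ ^ 2 + 2 * h * K * (1 + ‖y‖ ^ 2) + min 1 (h ^ 2 * ‖μ y‖ ^ 2) := by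
  set θ : ℝ := (1 + h * ‖μ y‖)⁻¹ with hθ
  have hden : 1 ≤ 1 + h * ‖μ y‖ := le_add_of_nonneg_right (by positivity)
  have hθ0 : 0 ≤ θ := by positivity
  have hθ1 : θ ≤ 1 := inv_le_one_of_one_le₀ hden
  have hnorm : ‖tamedDrift μ h y‖ = θ * (h * ‖μ y‖) := by
    rw [tamedDrift, norm_smul, norm_smul, ← hθ, Real.norm_of_nonneg hθ0, Real.norm_of_nonneg hh]
  have hn1 : ‖tamedDrift μ h y‖ ≤ 1 := by
    rw [hnorm, hθ, inv_mul_eq_div]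
    exact div_le_one_of_le₀ (by linarith) (by linarith)
  have hn2 : ‖tamedDrift μ h y‖ ≤ h * ‖μ y‖ := by
    rw [hnorm]
    exact mul_le_of_le_one_left (by positivity) hθ1
  have hsq : ‖tamedDrift μ h y‖ ^ 2 ≤ min 1 (h ^ 2 * ‖μ y‖ ^ 2) := by
    rw [← mul_pow]
    exact le_min (pow_le_one₀ (norm_nonneg _) hn1) (by gcongr)
  have hinner : inner ℝ y (tamedDrift μ h y) ≤ h * K * (1 + ‖y‖ ^ 2) := by
    rw [tamedDrift, inner_smul_right, inner_smul_right, ← hθ]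
    calc θ * (h * inner ℝ y (μ y)) ≤ θ * (h * (K * (1 + ‖y‖ ^ 2))) := by gcongr
      _ ≤ 1 * (h * (K * (1 + ‖y‖ ^ 2))) := by gcongr
      _ = _ := by ring
  rw [norm_add_sq_real]
  linarith

/-- Mean value inequality on the ball of radius `‖y‖`, with the real exponent rounded up to a
natural number. -/
theorem exists_norm_sq_le_of_norm_fderiv_le {μ : E → E} (hμ : Differentiable ℝ μ) {c : ℝ}
    (hc : 0 ≤ c) (hμ' : ∀ x, ‖fderiv ℝ μ x‖ ≤ c * (1 + ‖x‖ ^ c)) :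
    ∃ (κ : ℝ) (s : ℕ), 0 ≤ κ ∧ ∀ y, ‖μ y‖ ^ 2 ≤ κ * (1 + ‖y‖ ^ 2) ^ s := by
  refine ⟨(‖μ 0‖ + 2 * c) ^ 2, 2 * (⌈c⌉₊ + 1), by positivity, fun y => ?_⟩
  set u : ℝ := 1 + ‖y‖ ^ 2 with hu
  have hu1 : 1 ≤ u := le_add_of_nonneg_right (by positivity)
  have hyu : ‖y‖ ≤ u := by nlinarith [sq_nonneg (‖y‖ - 1)]
  have hpow : ‖y‖ ^ c ≤ u ^ ⌈c⌉₊ := by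
    calc ‖y‖ ^ c ≤ u ^ c := Real.rpow_le_rpow (norm_nonneg _) hyu hc
      _ ≤ u ^ (⌈c⌉₊ : ℝ) := Real.rpow_le_rpow_of_exponent_le hu1 (Nat.le_ceil c)
      _ = _ := Real.rpow_natCast _ _
  have h1 : ‖μ y - μ 0‖ ≤ c * (1 + ‖y‖ ^ c) * ‖y - 0‖ := by
    refine (convex_closedBall (0 : E) ‖y‖).norm_image_sub_le_of_norm_fderiv_le (𝕜 := ℝ)
      (fun x _ => hμ x) (fun x hx => (hμ' x).trans ?_) (by simp) (by simp)
    have : ‖x‖ ≤ ‖y‖ := by simpa using hx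
    gcongr
  have h2 : (1 : ℝ) ≤ u ^ ⌈c⌉₊ := one_le_pow₀ hu1
  have h3 : ‖μ y‖ ≤ (‖μ 0‖ + 2 * c) * u ^ (⌈c⌉₊ + 1) := by
    calc ‖μ y‖ ≤ ‖μ 0‖ + ‖μ y - μ 0‖ := norm_le_norm_add_norm_sub' _ _
      _ ≤ ‖μ 0‖ + c * (u ^ ⌈c⌉₊ + u ^ ⌈c⌉₊) * u := by
        rw [sub_zero] at h1
        have h4 : c * (1 + ‖y‖ ^ c) * ‖y‖ ≤ c * (u ^ ⌈c⌉₊ + u ^ ⌈c⌉₊) * u := by gcongr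
        linarith
      _ ≤ ‖μ 0‖ * u ^ (⌈c⌉₊ + 1) + c * (u ^ ⌈c⌉₊ + u ^ ⌈c⌉₊) * u := by
        gcongr
        exact le_mul_of_one_le_right (norm_nonneg _) (one_le_pow₀ hu1)
      _ = _ := by ring
  calc ‖μ y‖ ^ 2 ≤ ((‖μ 0‖ + 2 * c) * u ^ (⌈c⌉₊ + 1)) ^ 2 := by gcongr
    _ = _ := by rw [mul_pow, ← pow_mul, mul_comm (⌈c⌉₊ + 1)]

end TamedDrift

/-! ### Uniform moment bounds for the tamed scheme -/

section TamedScheme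

variable {Ω E E' : Type*} {mΩ : MeasurableSpace Ω}
  [NormedAddCommGroup E] [InnerProductSpace ℝ E] [FiniteDimensional ℝ E]
  [MeasurableSpace E] [BorelSpace E]
  [NormedAddCommGroup E'] [InnerProductSpace ℝ E'] [FiniteDimensional ℝ E']
  [MeasurableSpace E'] [BorelSpace E']
  {P : Measure Ω} [IsProbabilityMeasure P] {T : ℝ} {μ : E → E} {S : E → E' →L[ℝ] E} {ξ : Ω → E}
  {K Λ : ℝ}

theorem exists_setLIntegral_tamed_le (hT : 0 < T) (hμm : Measurable μ)
    (hξ : ∀ k : ℕ, ∫⁻ ω, ENNReal.ofReal ((1 + ‖ξ ω‖ ^ 2) ^ k) ∂P < ∞) (hK : 0 ≤ K) (hΛ : 0 ≤ Λ)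
    (hμ : ∀ y, inner ℝ y (μ y) ≤ K * (1 + ‖y‖ ^ 2)) (hS : ∀ y, ‖S y‖ ≤ Λ * √(1 + ‖y‖ ^ 2))
    (k : ℕ) :
    ∃ C < ∞, ∀ (N : ℕ) (𝓖 : Filtration ℕ mΩ) (G : ℕ → Ω → E') (Y : ℕ → Ω → E), 1 ≤ N →
      IsEulerScheme P 𝓖 N (T / N) (tamedDrift μ (T / N)) S G Y → Y 0 = ξ → ∀ n ≤ N,
      ∫⁻ ω in staysIn Y {y | ‖μ y‖ ^ 2 ≤ N} n, ENNReal.ofReal ((1 + ‖Y n ω‖ ^ 2) ^ k) ∂P ≤ C ∧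
      ∫⁻ ω, ENNReal.ofReal ((N + ‖Y n ω‖ ^ 2) ^ k) ∂P ≤ ENNReal.ofReal ((N : ℝ) ^ k) * C := by
  obtain ⟨C, hC, hstep⟩ := exists_lintegral_pow_add_norm_sq_le (E := E') (F := E) k (T := T)
    -- `2 * K` comes from the one-sided bound, `T` from `h² N = h T` on `D`, and `1 / T` from `1 = h
    -- N / T` in the global case.
    (by positivity : 0 ≤ 2 * K + T + 1 / T) hΛ
  refine ⟨ENNReal.ofReal (Real.exp (C * T)) *
    ∫⁻ ω, ENNReal.ofReal ((1 + ‖ξ ω‖ ^ 2) ^ k) ∂P,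
    ENNReal.mul_lt_top ENNReal.ofReal_lt_top (hξ k), fun N 𝓖 G Y hN hY hY0 n hn => ?_⟩
  have hN1 : (1 : ℝ) ≤ N := by exact_mod_cast hN
  have hN0 : (0 : ℝ) < N := by linarith
  set h : ℝ := T / N with hh
  have hNh : N * h = T := by rw [hh]; field_simp
  have hh0 : 0 ≤ h := by positivity
  have hhT : h ≤ T := div_le_self hT.le hN1
  have hexp : Real.exp (n * (C * h)) ≤ Real.exp (C * T) := by
    have hn' : (n : ℝ) ≤ N := by exact_mod_cast hn
    refine Real.exp_le_exp.2 ?_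
    calc n * (C * h) ≤ N * (C * h) := by gcongr
      _ = C * T := by rw [← hNh]; ring
  have hSM : ∀ (M : ℝ) y, 1 ≤ M → ‖S y‖ ≤ Λ * √(M + ‖y‖ ^ 2) := fun M y hM =>
    (hS y).trans (by gcongr)
  have hdrift := fun y => norm_add_tamedDrift_sq_le hh0 hK (hμ y)
  constructor
  · have hD : MeasurableSet {y | ‖μ y‖ ^ 2 ≤ N} :=
      measurableSet_le (by fun_prop) measurable_const
    refine (hY.setLIntegral_le hD (k := k) (M := 1) (C := C * h) ?_ hn).trans ?_
    · intro y hy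
      refine hstep h 1 (1 + ‖y‖ ^ 2) (y + tamedDrift μ h y) (S y) hh0 hhT zero_le_one
        (by positivity) ?_ (hSM 1 y le_rfl)
      have h1 : h ^ 2 * ‖μ y‖ ^ 2 ≤ h * T * (1 + ‖y‖ ^ 2) := by
        calc h ^ 2 * ‖μ y‖ ^ 2 ≤ h ^ 2 * N := by gcongr; exact hy
          _ = h * T := by rw [← hNh]; ring
          _ ≤ h * T * (1 + ‖y‖ ^ 2) :=
            le_mul_of_one_le_right (by positivity) (le_add_of_nonneg_right (by positivity))
      have h2 : 0 ≤ 1 / T * h * (1 + ‖y‖ ^ 2) := by positivity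
      have h3 := min_le_right 1 (h ^ 2 * ‖μ y‖ ^ 2)
      linarith [hdrift y]
    · rw [hY0]
      gcongr
  -- Taking `D` to be the whole space turns the localized estimate into a global one.
  · have huniv : staysIn Y Set.univ n = Set.univ := by ext; simp [staysIn]
    have hmom := hY.setLIntegral_le MeasurableSet.univ (k := k) (M := N) (C := C * h) ?_ hn
    · rw [huniv, setLIntegral_univ, hY0] at hmom
      calc ∫⁻ ω, ENNReal.ofReal ((N + ‖Y n ω‖ ^ 2) ^ k) ∂P
          ≤ ENNReal.ofReal (Real.exp (n * (C * h))) *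
            ∫⁻ ω, ENNReal.ofReal ((N + ‖ξ ω‖ ^ 2) ^ k) ∂P := hmom
        _ ≤ ENNReal.ofReal (Real.exp (C * T)) * ∫⁻ ω, ENNReal.ofReal ((N : ℝ) ^ k) *
              ENNReal.ofReal ((1 + ‖ξ ω‖ ^ 2) ^ k) ∂P := by
            gcongr with ω
            rw [← ENNReal.ofReal_mul (by positivity), ← mul_pow]
            gcongr
            nlinarith [sq_nonneg ‖ξ ω‖]
        _ = _ := by
            rw [lintegral_const_mul' _ _ ENNReal.ofReal_ne_top, mul_left_comm]
    · intro y _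
      refine hstep h N (N + ‖y‖ ^ 2) (y + tamedDrift μ h y) (S y) hh0 hhT hN0.le
        (by positivity) ?_ (hSM N y hN1)
      have h1 : 1 ≤ 1 / T * h * (N + ‖y‖ ^ 2) := by
        calc (1 : ℝ) = 1 / T * h * N := by rw [mul_assoc, mul_comm h, hNh]; field_simp
          _ ≤ 1 / T * h * (N + ‖y‖ ^ 2) := by
            gcongr
            exact le_add_of_nonneg_right (by positivity)
      have h2 : 0 ≤ T * h * (N + ‖y‖ ^ 2) := by positivity
      have h3 := min_le_left 1 (h ^ 2 * ‖μ y‖ ^ 2)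
      have h4 : 2 * h * K * (1 + ‖y‖ ^ 2) ≤ 2 * h * K * (N + ‖y‖ ^ 2) := by gcongr
      linarith [hdrift y]

theorem exists_lintegral_tamed_le (hT : 0 < T) (hμm : Measurable μ)
    (hξ : ∀ k : ℕ, ∫⁻ ω, ENNReal.ofReal ((1 + ‖ξ ω‖ ^ 2) ^ k) ∂P < ∞) (hK : 0 ≤ K) (hΛ : 0 ≤ Λ)
    (hμ : ∀ y, inner ℝ y (μ y) ≤ K * (1 + ‖y‖ ^ 2)) (hS : ∀ y, ‖S y‖ ≤ Λ * √(1 + ‖y‖ ^ 2))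
    {κ : ℝ} {s : ℕ} (hκ : 0 ≤ κ) (hgrowth : ∀ y, ‖μ y‖ ^ 2 ≤ κ * (1 + ‖y‖ ^ 2) ^ s) (k : ℕ) :
    ∃ C < ∞, ∀ (N : ℕ) (𝓖 : Filtration ℕ mΩ) (G : ℕ → Ω → E') (Y : ℕ → Ω → E), 1 ≤ N →
      IsEulerScheme P 𝓖 N (T / N) (tamedDrift μ (T / N)) S G Y → Y 0 = ξ → ∀ n ≤ N,
      ∫⁻ ω, ENNReal.ofReal ((1 + ‖Y n ω‖ ^ 2) ^ k) ∂P ≤ C := by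
  have key := exists_setLIntegral_tamed_le hT hμm hξ hK hΛ hμ hS
  obtain ⟨C₁, hC₁, h₁⟩ := key k
  obtain ⟨C₂, hC₂, h₂⟩ := key (2 * k)
  obtain ⟨C₃, hC₃, h₃⟩ := key (s * (2 * k + 1))
  refine ⟨C₁ + C₂ + ENNReal.ofReal (κ ^ (2 * k + 1)) * C₃,
    ENNReal.add_lt_top.2 ⟨ENNReal.add_lt_top.2 ⟨hC₁, hC₂⟩,
      ENNReal.mul_lt_top ENNReal.ofReal_lt_top hC₃⟩, fun N 𝓖 G Y hN hY hY0 n hn => ?_⟩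
  refine lintegral_le_of_localized hY.measurable
    (measurableSet_le (by fun_prop) measurable_const : MeasurableSet {y | ‖μ y‖ ^ 2 ≤ N}) hN hκ
    (fun y hy => (not_le.1 hy).le.trans (hgrowth y))
    (fun n hn => (h₁ N 𝓖 G Y hN hY hY0 n hn).1) (fun n hn => (h₂ N 𝓖 G Y hN hY hY0 n hn).2)
    (fun n hn => (h₃ N 𝓖 G Y hN hY hY0 n hn).1) hn

end TamedScheme

/-! ### Application to Brownian motion and real exponents -/

theorem gridTime_monotone {T : ℝ} (hT : 0 ≤ T) (N : ℕ) : Monotone (gridTime hT N) := by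
  intro i j hij
  refine Set.monotone_projIcc hT ?_
  gcongr

theorem isEulerScheme_tamedEuler {Ω : Type*} {mΩ : MeasurableSpace Ω} {P : Measure Ω}
    {T : ℝ} (hT : 0 < T) {F : Filtration (Set.Icc (0 : ℝ) T) mΩ} {d m : ℕ}
    {W : Set.Icc (0 : ℝ) T → Ω → EuclideanSpace ℝ (Fin m)}
    (hW : IsStandardBrownianMotion P hT.le F W) {ξ : Ω → EuclideanSpace ℝ (Fin d)}
    (hξ : Measurable[F ⟨0, Set.left_mem_Icc.mpr hT.le⟩] ξ)
    {μ : EuclideanSpace ℝ (Fin d) → EuclideanSpace ℝ (Fin d)} (hμ : Measurable μ)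
    {σ : EuclideanSpace ℝ (Fin d) → Matrix (Fin d) (Fin m) ℝ}
    (hσ : Continuous fun y => LinearMap.toContinuousLinearMap (Matrix.toEuclideanLin (σ y)))
    {N : ℕ} (hN : 1 ≤ N) :
    -- Past `N` the projected grid stays at `T`, so this is a filtration on all of `ℕ`; independence
    -- and law are required only for `n < N`.
    IsEulerScheme P ⟨fun n => F (gridTime hT.le N n),
        fun _ _ hij => F.mono (gridTime_monotone hT.le N hij), fun _ => F.le _⟩
      N (T / N) (tamedDrift μ (T / N))
      (fun y => LinearMap.toContinuousLinearMap (Matrix.toEuclideanLin (σ y)))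
      (fun n ω => W (gridTime hT.le N (n + 1)) ω - W (gridTime hT.le N n) ω)
      (tamedEuler hT.le μ σ W ξ N) where
  measurable_drift := by
    unfold tamedDrift
    fun_prop
  continuous_diffusion := hσ
  measurable_increment n :=
    ((hW.adapted _).mono (F.le _) le_rfl).sub ((hW.adapted _).mono (F.le _) le_rfl)
  adapted n := by
    have hdrift : Measurable (tamedDrift μ (T / N)) := by
      unfold tamedDrift
      fun_prop
    have hmap : Measurable fun p : EuclideanSpace ℝ (Fin d) × EuclideanSpace ℝ (Fin m) =>
        p.1 + tamedDrift μ (T / N) p.1 +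
          LinearMap.toContinuousLinearMap (Matrix.toEuclideanLin (σ p.1)) p.2 := by
      refine Measurable.add (by fun_prop) ?_
      exact ((hσ.comp continuous_fst).clm_apply continuous_snd).measurable
    induction n with
    | zero => exact hξ.mono (F.mono (Subtype.coe_le_coe.1 (gridTime hT.le N 0).2.1)) le_rfl
    | succ n ih =>
      have hle := F.mono (gridTime_monotone hT.le N n.le_succ)
      exact hmap.comp ((ih.mono hle le_rfl).prodMk
        ((hW.adapted _).sub ((hW.adapted _).mono hle le_rfl)))
  indep n _ := hW.indep_increment _ _ (gridTime_monotone hT.le N n.le_succ)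
  law n hn := by
    rw [(hW.hasLaw_increment _ _ (gridTime_monotone hT.le N n.le_succ)).map_eq,
      coe_gridTime hT.le (by omega : n + 1 ≤ N), coe_gridTime hT.le hn.le,
      ← multivariateGaussian_zero_smul_one (by positivity)]
    congr 2
    push_cast
    ring
  step n ω := rfl

theorem lintegral_one_add_norm_sq_pow_lt_top {Ω E : Type*} {mΩ : MeasurableSpace Ω}
    {P : Measure Ω} [IsFiniteMeasure P] [NormedAddCommGroup E] {ξ : Ω → E}
    (hξ : ∀ p : ℝ, 1 ≤ p → ∫⁻ ω, ‖ξ ω‖ₑ ^ p ∂P < ∞) (k : ℕ) :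
    ∫⁻ ω, ENNReal.ofReal ((1 + ‖ξ ω‖ ^ 2) ^ k) ∂P < ∞ := by
  have hpt : ∀ ω, ENNReal.ofReal ((1 + ‖ξ ω‖ ^ 2) ^ k) ≤
      -- The exponent `2k + 1` rather than `2k` stays at least `1` even when `k = 0`, as `hξ`
      -- demands.
      2 ^ k * (1 + ‖ξ ω‖ₑ ^ ((2 * k + 1 : ℕ) : ℝ)) := by
    intro ω
    set x : ℝ := ‖ξ ω‖ with hx
    have hx0 : 0 ≤ x := norm_nonneg _
    have hreal : (1 + x ^ 2) ^ k ≤ 2 ^ k * (1 + x ^ (2 * k + 1)) := by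
      rcases le_total x 1 with h | h
      · calc (1 + x ^ 2) ^ k ≤ 2 ^ k := by gcongr; nlinarith
          _ ≤ _ := le_mul_of_one_le_right (by positivity)
            (le_add_of_nonneg_right (by positivity))
      · calc (1 + x ^ 2) ^ k ≤ (2 * x ^ 2) ^ k := by gcongr; nlinarith
          _ = 2 ^ k * x ^ (2 * k) := by rw [mul_pow, ← pow_mul]
          _ ≤ 2 ^ k * (1 + x ^ (2 * k + 1)) := by
            gcongr
            have := pow_le_pow_right₀ h (by omega : 2 * k ≤ 2 * k + 1)
            linarith
    calc ENNReal.ofReal ((1 + x ^ 2) ^ k)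
        ≤ ENNReal.ofReal (2 ^ k * (1 + x ^ (2 * k + 1))) := ENNReal.ofReal_le_ofReal hreal
      _ = _ := by
        rw [ENNReal.ofReal_mul (by positivity), ENNReal.ofReal_add (by positivity) (by positivity),
          ENNReal.ofReal_pow (by positivity), ENNReal.ofReal_pow hx0, hx, ofReal_norm,
          ENNReal.rpow_natCast]
        simp
  refine (lintegral_mono hpt).trans_lt ?_
  rw [lintegral_const_mul' _ _ (by simp), lintegral_add_left measurable_const, lintegral_one]
  refine ENNReal.mul_lt_top (by simp) (ENNReal.add_lt_top.2 ⟨measure_lt_top _ _, hξ _ ?_⟩)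
  norm_cast
  omega

theorem enorm_rpow_le_ofReal_pow {E : Type*} [NormedAddCommGroup E] {p : ℝ} (hp : 0 ≤ p) (y : E) :
    ‖y‖ₑ ^ p ≤ ENNReal.ofReal ((1 + ‖y‖ ^ 2) ^ ⌈p⌉₊) := by
  rw [← ofReal_norm, ENNReal.ofReal_rpow_of_nonneg (norm_nonneg y) hp]
  apply ENNReal.ofReal_le_ofReal
  have h1 : (1 : ℝ) ≤ 1 + ‖y‖ ^ 2 := le_add_of_nonneg_right (by positivity)
  calc ‖y‖ ^ p ≤ (1 + ‖y‖ ^ 2) ^ p :=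
        Real.rpow_le_rpow (norm_nonneg _) (by nlinarith [sq_nonneg (‖y‖ - 1)]) hp
    _ ≤ (1 + ‖y‖ ^ 2) ^ (⌈p⌉₊ : ℝ) := Real.rpow_le_rpow_of_exponent_le h1 (Nat.le_ceil p)
    _ = _ := Real.rpow_natCast _ _

theorem lemma3p9 {Ω : Type*} {mΩ : MeasurableSpace Ω} (P : Measure Ω) [IsProbabilityMeasure P]
    (T : ℝ) (hT : 0 < T) (F : Filtration (Set.Icc (0 : ℝ) T) mΩ)
    (hF : IsNormalFiltration P hT.le F)
    (d m : ℕ) (hd : 1 ≤ d) (hm : 1 ≤ m)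
    (W : Set.Icc (0 : ℝ) T → Ω → EuclideanSpace ℝ (Fin m))
    (hW : IsStandardBrownianMotion P hT.le F W)
    (ξ : Ω → EuclideanSpace ℝ (Fin d))
    (hξ : Measurable[F ⟨0, Set.left_mem_Icc.mpr hT.le⟩] ξ)
    (hξ_moments : ∀ p : ℝ, 1 ≤ p → ∫⁻ ω, ‖ξ ω‖ₑ ^ p ∂P < ∞)
    (μ : EuclideanSpace ℝ (Fin d) → EuclideanSpace ℝ (Fin d)) (hμ : ContDiff ℝ 1 μ)
    (σ : EuclideanSpace ℝ (Fin d) → Matrix (Fin d) (Fin m) ℝ)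
    (c : ℝ) (hc : 0 < c)
    (hμ_deriv : ∀ x, ‖fderiv ℝ μ x‖ ≤ c * (1 + ‖x‖ ^ c))
    (hσ : ∀ x y, ‖σ x - σ y‖ ≤ c * ‖x - y‖)
    (hμ_oneSided : ∀ x y, inner ℝ (x - y) (μ x - μ y) ≤ c * ‖x - y‖ ^ 2)
    (p : ℝ) (hp : 1 ≤ p) :
    (⨆ (N : ℕ) (_ : 1 ≤ N) (n : ℕ) (_ : n ≤ N),
      ∫⁻ ω, ‖tamedEuler hT.le μ σ W ξ N n ω‖ₑ ^ p ∂P) < ∞ := by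
  have hμm : Measurable μ := hμ.continuous.measurable
  -- The matrix norm in scope is by definition this operator norm.
  have hσnorm : ∀ A : Matrix (Fin d) (Fin m) ℝ,
      ‖LinearMap.toContinuousLinearMap (Matrix.toEuclideanLin A)‖ = ‖A‖ := fun _ => rfl
  have hσcont : Continuous fun y =>
      LinearMap.toContinuousLinearMap (Matrix.toEuclideanLin (σ y)) := by
    refine (LipschitzWith.of_dist_le_mul (K := ⟨c, hc.le⟩) fun x y => ?_).continuous
    rw [dist_eq_norm, dist_eq_norm, ← map_sub, ← map_sub, hσnorm]
    exact hσ x y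
  have hσgrowth : ∀ y, ‖LinearMap.toContinuousLinearMap (Matrix.toEuclideanLin (σ y))‖ ≤
      (‖σ 0‖ + c) * √(1 + ‖y‖ ^ 2) := by
    intro y
    have h1 : ‖y‖ ≤ √(1 + ‖y‖ ^ 2) := Real.le_sqrt_of_sq_le (by linarith)
    have h2 : 1 ≤ √(1 + ‖y‖ ^ 2) := Real.one_le_sqrt.2 (le_add_of_nonneg_right (by positivity))
    rw [hσnorm]
    calc ‖σ y‖ ≤ ‖σ 0‖ + ‖σ y - σ 0‖ := norm_le_norm_add_norm_sub' _ _
      _ ≤ ‖σ 0‖ * 1 + c * ‖y‖ := by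
        have := hσ y 0
        rw [sub_zero] at this
        linarith
      _ ≤ ‖σ 0‖ * √(1 + ‖y‖ ^ 2) + c * √(1 + ‖y‖ ^ 2) := by gcongr
      _ = _ := by ring
  obtain ⟨κ, s, hκ, hgrowth⟩ := exists_norm_sq_le_of_norm_fderiv_le
    (hμ.differentiable one_ne_zero) hc.le hμ_deriv
  obtain ⟨C, hC, hbound⟩ := exists_lintegral_tamed_le hT hμm
    (lintegral_one_add_norm_sq_pow_lt_top hξ_moments) (by positivity) (by positivity)
    (inner_self_le_of_oneSided hc.le hμ_oneSided) hσgrowth hκ hgrowth ⌈p⌉₊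
  refine lt_of_le_of_lt (iSup₂_le fun N hN => iSup₂_le fun n hn => ?_) hC
  exact (lintegral_mono fun ω => enorm_rpow_le_ofReal_pow (by linarith) _).trans
    (hbound N _ _ _ hN (isEulerScheme_tamedEuler hT hW hξ hμm hσcont hN) rfl n hn)
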